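/- Let $n\ge 1$ be an integer, let $p,q_1,\dots,q_n\in\mathbb{C}[z]$ be polynomials with $p(0)=0$ and $q_i(0)=0$ for $i=1,\dots,n$. Assume that $p\neq 0$ and that $p(z)\neq\zeta z$ for every root of unity $\zeta\in\mathbb{C}$ (in particular $p(z)\ne z$). Let $\chi_1,\dots,\chi_n\in\mathbb{C}((z))$ be formal Laurent series (for instance formal power series) satisfying $$\chi_i(z)=\chi_i(p(z))+q_i(z),\qquad i=1,\dots,n,$$ where, for a Laurent series $f=z^k g$ with $k\in\mathbb{Z}$ and $g\in\mathbb{C}[[z]]$, $f(p(z))$ denotes $p(z)^k\,g(p(z))\in\mathbb{C}((z))$. Suppose that $1,q_1,\dots,q_n$ are linearly independent over $\mathbb{C}$ and that at least one of the following two conditions holds: (a) $\deg p$ does not divide $\deg\left(\sum_{i=1}^n s_iq_i\right)$ for any $(s_1,\dots,s_n)\in\mathbb{C}^n\setminus\{0\}$; (b) $\sum_{i=1}^n s_i\chi_i\notin\mathbb{C}[z]$ for every $(s_1,\dots,s_n)\in\mathbb{C}^n\setminus\{0\}$. Then $\chi_1,\dots,\chi_n$ are algebraically independent over the field $\mathbb{C}(z)$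 of rational functions. -/

import Mathlib

open Polynomial
open scoped RatFunc

/-- The composition `f(p(z))` of a formal Laurent series `f ∈ ℂ((z))` with a nonzero polynomial `p`
without constant term: writing `f = z ^ k * g` with `k = ord f` and `g ∈ ℂ[[z]]`, it is
`p ^ k * g(p)`, where `g(p)` is the usual substitution in formal power series. -/
noncomputable def laurentComp (f : LaurentSeries ℂ) (p : ℂ[X]) : LaurentSeries ℂ :=
  ((p : PowerSeries ℂ) : LaurentSeries ℂ) ^ f.order *
    ((f.powerSeriesPart.subst (p : PowerSeries ℂ) : PowerSeries ℂ) : LaurentSeries ℂ)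

/-! Composition with `p` is a field endomorphism `σ` of ℂ((z)) that maps ℂ(z) into itself, and each
`χ i - σ (χ i)` is a polynomial. Since `p` is not a root of unity times `z`, the field of constants
is ℂ (`mem_range_algebraMap_of_fixed`). An Ostrowski-type theorem
(`algebraicIndependent_of_sub_map_mem_range`) then says that an algebraic relation over ℂ(z) forces
a linear one: some nontrivial ℂ-combination of the `χ i` is a rational function `f`. As `f - f ∘ p`
is a polynomial, `f` cannot have poles (`exists_polynomial_of_sub_map_eq`), which contradicts (b).
It contradicts (a) too, because `deg p` divides `deg (f - f ∘ p)`. -/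

section DifferenceField

/-! ### Difference fields: adjoining one element -/

variable {E L : Type*} [Field E] [Field L] [Algebra E L] (τ : E →+* E) (σ : L →+* L) (q : E)

/-- The coefficientwise action of `τ` followed by the shift `T ↦ T - q`. -/
noncomputable def twistedShift : E[X] →+* E[X] :=
  (taylorAlgHom (-q)).toRingHom.comp (mapRingHom τ)

lemma twistedShift_apply (A : E[X]) : twistedShift τ q A = taylor (-q) (A.map τ) := rfl

lemma natDegree_twistedShift (A : E[X]) : (twistedShift τ q A).natDegree = A.natDegree := by
  rw [twistedShift_apply, natDegree_taylor, natDegree_map]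

lemma degree_twistedShift (A : E[X]) : (twistedShift τ q A).degree = A.degree := by
  rw [twistedShift_apply, degree_taylor, degree_map]

lemma Polynomial.Monic.twistedShift {A : E[X]} (hA : A.Monic) : (twistedShift τ q A).Monic := by
  rw [Monic, twistedShift_apply, leadingCoeff_taylor]
  exact hA.map τ

/-- Since `σ x = x - q`, applying `σ` to a polynomial expression in `x` is a change of polynomial,
so `σ`-invariance can be studied on coefficients. -/
lemma aeval_twistedShift {σ : L →+* L} (hσ : ∀ e, σ (algebraMap E L e) = algebraMap E L (τ e))
    {x : L} (hx : x - σ x = algebraMap E L q) (A : E[X]) :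
    aeval x (twistedShift τ q A) = σ (aeval x A) := by
  have hx' : σ x = x - algebraMap E L q := by rw [← hx]; ring
  induction A using Polynomial.induction_on' with
  | add A B hA hB => simp only [map_add, hA, hB]
  | monomial n a =>
    simp [twistedShift_apply, aeval_monomial, taylor_monomial, hσ, hx', sub_eq_add_neg]

lemma Polynomial.taylor_coeff_of_natDegree_le {R : Type*} [CommRing R] (r : R) {A : R[X]} {k : ℕ}
    (hA : A.natDegree ≤ k + 1) :
    (taylor r A).coeff k = A.coeff k + (k + 1) * A.coeff (k + 1) * r := by
  have h : (hasseDeriv k A).natDegree < 2 :=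
    lt_of_le_of_lt (natDegree_hasseDeriv_le A k) (by omega)
  rw [taylor_coeff, eval_eq_sum_range' h]
  simp [Finset.sum_range_succ, hasseDeriv_coeff, add_comm 1 k, Nat.choose_succ_self_right]

lemma coeff_twistedShift {A : E[X]} {k : ℕ} (hA : A.natDegree ≤ k + 1) :
    (twistedShift τ q A).coeff k = τ (A.coeff k) - (k + 1) * τ (A.coeff (k + 1)) * q := by
  rw [twistedShift_apply, taylor_coeff_of_natDegree_le _ (by rwa [natDegree_map])]
  simp only [coeff_map]
  ring

lemma coeff_twistedShift_natDegree (A : E[X]) :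
    (twistedShift τ q A).coeff A.natDegree = τ A.leadingCoeff := by
  rw [coeff_twistedShift τ q (Nat.le_succ _), coeff_eq_zero_of_natDegree_lt (Nat.lt_succ_self _)]
  simp

variable {τ σ q}

lemma mem_range_of_sub_eq_sub
    (hconst : ∀ y, σ y = y → y ∈ Set.range (algebraMap E L))
    {x : L} {v : E} (h : x - σ x = algebraMap E L v - σ (algebraMap E L v)) :
    x ∈ Set.range (algebraMap E L) := by
  obtain ⟨c, hc⟩ := hconst (x - algebraMap E L v) (by
    rw [map_sub]; linear_combination -h)
  exact ⟨c + v, by rw [map_add, hc]; ring⟩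

variable [CharZero E]

/-- The minimal polynomial is invariant under the twisted shift; its subleading coefficient then
yields `v` in `E` with `v - τ v = q`, and `x - v` is a constant. -/
lemma mem_range_of_isAlgebraic
    (hσ : ∀ e, σ (algebraMap E L e) = algebraMap E L (τ e))
    (hconst : ∀ y, σ y = y → y ∈ Set.range (algebraMap E L))
    {x : L} (hx : x - σ x = algebraMap E L q) (halg : IsAlgebraic E x) :
    x ∈ Set.range (algebraMap E L) := by
  have hint : IsIntegral E x := halg.isIntegral
  set P := minpoly E x with hP
  have hmon : P.Monic := minpoly.monic hint
  have hfix : twistedShift τ q P = P := by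
    apply eq_of_monic_of_dvd_of_natDegree_le hmon (hmon.twistedShift τ q)
    · apply minpoly.dvd
      rw [aeval_twistedShift τ q hσ hx, minpoly.aeval, map_zero]
    · rw [natDegree_twistedShift]
  obtain ⟨m, hm⟩ : ∃ m, P.natDegree = m + 1 :=
    Nat.exists_eq_succ_of_ne_zero (minpoly.natDegree_pos hint).ne'
  have hlead : P.coeff (m + 1) = 1 := by rw [← hm]; exact hmon
  have hc := coeff_twistedShift τ q hm.le
  rw [hfix, hlead, map_one, mul_one] at hc
  have hm0 : (m + 1 : E) ≠ 0 := by exact_mod_cast Nat.succ_ne_zero m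
  refine mem_range_of_sub_eq_sub hconst (v := -P.coeff m / (m + 1)) ?_
  rw [hx, hσ, ← map_sub]
  congr 1
  simp only [map_div₀, map_neg, map_add, map_one, map_natCast]
  field_simp
  linear_combination hc

/-- Ostrowski's criterion, one step: if `x` does not lie in `E`, then the elements `y` of `E(x)` with
`y - σ y ∈ E` are congruent modulo `E` to multiples of `x` by constants. -/
lemma exists_const_mul_sub_mem_range
    (hσ : ∀ e, σ (algebraMap E L e) = algebraMap E L (τ e))
    (hconst : ∀ y, σ y = y → y ∈ Set.range (algebraMap E L))
    {x : L} (hx : x - σ x = algebraMap E L q) (hxE : x ∉ Set.range (algebraMap E L))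
    {y : L} {e : E} (hy : y - σ y = algebraMap E L e) {r s : E[X]}
    (hrs : y = aeval x r / aeval x s) :
    ∃ c : E, τ c = c ∧ y - algebraMap E L c * x ∈ Set.range (algebraMap E L) := by
  have htr : Transcendental E x := fun h => hxE (mem_range_of_isAlgebraic hσ hconst hx h)
  have hinj : Function.Injective (aeval x : E[X] →ₐ[E] L) :=
    transcendental_iff_injective.mp htr
  have hne : ∀ {A : E[X]}, A ≠ 0 → aeval x A ≠ 0 := fun hA h =>
    hA (hinj (by rw [h, map_zero]))
  obtain ⟨A, B, hmon, hcop, hAB⟩ : ∃ A B : E[X], B.Monic ∧ IsCoprime A B ∧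
      y * aeval x B = aeval x A := by
    -- Division by zero gives `y = 0` when `s = 0`; otherwise reduce to lowest terms.
    rcases eq_or_ne s 0 with rfl | hs
    · exact ⟨0, 1, monic_one, isCoprime_one_right, by simp [hrs]⟩
    · set f : RatFunc E := algebraMap _ _ r / algebraMap _ _ s with hf
      have h := (RatFunc.num_mul_eq_mul_denom_iff hs).2 hf
      refine ⟨f.num, f.denom, f.monic_denom, f.isCoprime_num_denom, ?_⟩
      rw [hrs, div_mul_eq_mul_div, div_eq_iff (hne hs), ← map_mul, ← map_mul, h]
  have hB0 := hne hmon.ne_zero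
  set t := twistedShift τ q with ht
  have hts : ∀ A, aeval x (t A) = σ (aeval x A) := aeval_twistedShift τ q hσ hx
  -- This is `y - σ y = e` with denominators cleared; coprimality then makes `B` divide `t B`.
  have hrel : A * t B - t A * B = C e * (B * t B) := by
    apply hinj
    have h1 : σ y * aeval x (t B) = aeval x (t A) := by rw [hts, hts, ← hAB, map_mul]
    simp only [map_sub, map_mul, aeval_C, ← hAB, ← h1, ← hy]
    ring
  have hBfix : t B = B := by
    refine eq_of_monic_of_dvd_of_natDegree_le hmon (hmon.twistedShift τ q) ?_
      (natDegree_twistedShift τ q B).le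
    refine hcop.symm.dvd_of_dvd_mul_left (y := A) ⟨t A + C e * t B, ?_⟩
    linear_combination hrel
  have hAfix : A - t A = C e * B := by
    rw [hBfix] at hrel
    exact mul_right_cancel₀ hmon.ne_zero (by linear_combination hrel)
  -- As `t` fixes `B` and preserves degrees, it commutes with division by `B`. So the remainder is
  -- fixed, and its quotient by `B` is a constant; its degree forces it to vanish.
  obtain ⟨hC, hR⟩ := div_modByMonic_unique (f := t A) (t (A /ₘ B)) (t (A %ₘ B)) hmon
    ⟨by conv_rhs => rw [← modByMonic_add_div A B, map_add, map_mul, hBfix], by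
      rw [ht, degree_twistedShift]; exact degree_modByMonic_lt A hmon⟩
  have htA : t A = A - C e * B := by linear_combination -hAfix
  have hR' : t (A %ₘ B) = A %ₘ B := by
    rw [← hR, htA, sub_modByMonic,
      (modByMonic_eq_zero_iff_dvd hmon).2 (dvd_mul_left B (C e)), sub_zero]
  have hR0 : A %ₘ B = 0 := by
    obtain ⟨c, hc⟩ := hconst (aeval x (A %ₘ B) / aeval x B) (by
      rw [map_div₀, ← hts, ← hts, hR', hBfix])
    have h1 : A %ₘ B = C c * B := by
      apply hinj
      rw [map_mul, aeval_C, hc, div_mul_cancel₀ _ hB0]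
    rw [← modByMonic_eq_self_iff hmon |>.2 (degree_modByMonic_lt A hmon), h1,
      modByMonic_eq_zero_iff_dvd hmon]
    exact dvd_mul_left B (C c)
  set D := A /ₘ B with hD
  have hADB : A = B * D := by
    conv_lhs => rw [← modByMonic_add_div A B, hR0, zero_add]
  have hyD : y = aeval x D := by
    apply mul_right_cancel₀ hB0
    rw [hAB, hADB, map_mul, mul_comm]
  have hDt : D - t D = C e := by
    apply hinj
    rw [map_sub, hts, aeval_C, ← hyD, hy]
  have hlead : 0 < D.natDegree → τ D.leadingCoeff = D.leadingCoeff := fun h => by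
    have := congrArg (fun F => coeff F D.natDegree) hDt
    simp only [coeff_sub, coeff_C, h.ne', if_false] at this
    rw [ht, coeff_twistedShift_natDegree] at this
    exact (sub_eq_zero.mp this).symm
  have hdeg : D.natDegree ≤ 1 := by
    by_contra! hlt
    obtain ⟨k, hk⟩ : ∃ k, D.natDegree = k + 1 + 1 := ⟨D.natDegree - 2, by omega⟩
    have hl := hlead (by omega)
    have hc := congrArg (fun F => coeff F (k + 1)) hDt
    simp only [coeff_sub, coeff_C, Nat.succ_ne_zero, if_false] at hc
    rw [ht, coeff_twistedShift τ q hk.le, ← hk] at hc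
    change _ - (_ - _ * τ D.leadingCoeff * q) = 0 at hc
    rw [hl] at hc
    have hl0 : D.leadingCoeff ≠ 0 := leadingCoeff_ne_zero.2 fun h => by simp [h] at hlt
    have hk0 : ((k + 1 : ℕ) + 1 : E) ≠ 0 := by exact_mod_cast Nat.succ_ne_zero (k + 1)
    -- In degree at least 2 the subleading coefficient over the degree times the fixed leading one
    -- again solves `v - τ v = q`.
    refine hxE (mem_range_of_sub_eq_sub hconst
      (v := -D.coeff (k + 1) / (((k + 1 : ℕ) + 1) * D.leadingCoeff)) ?_)
    rw [hx, hσ, ← map_sub]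
    congr 1
    simp only [map_div₀, map_neg, map_add, map_mul, map_one, map_natCast, hl]
    field_simp
    linear_combination hc
  have hDform := eq_X_add_C_of_natDegree_le_one hdeg
  rcases Nat.lt_or_ge 0 D.natDegree with h | h
  · have h1 : D.natDegree = 1 := le_antisymm hdeg h
    refine ⟨D.leadingCoeff, hlead h, D.coeff 0, ?_⟩
    rw [leadingCoeff, h1, hyD]
    conv_rhs => rw [hDform]
    simp
  · refine ⟨0, map_zero τ, D.coeff 0, ?_⟩
    rw [hyD, eq_C_of_natDegree_eq_zero (Nat.le_zero.mp h)]
    simp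

end DifferenceField

/-! ### Ostrowski's theorem by successive adjunction -/

section Ostrowski

variable {F K L ι : Type*} [Field F] [Field K] [Field L] [Algebra F L] [Algebra K L]
  {σ : L →+* L} {χ : ι → L}

lemma map_mem_adjoin_of_sub_map_mem_range
    (hK : ∀ k, σ (algebraMap K L k) ∈ Set.range (algebraMap K L))
    (hχ : ∀ i, χ i - σ (χ i) ∈ Set.range (algebraMap K L)) (S : Set ι) {y : L}
    (hy : y ∈ IntermediateField.adjoin K (χ '' S)) :
    σ y ∈ IntermediateField.adjoin K (χ '' S) := by
  induction hy using IntermediateField.adjoin_induction with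
  | mem x hx =>
    obtain ⟨i, hi, rfl⟩ := hx
    obtain ⟨k, hk⟩ := hχ i
    rw [show σ (χ i) = χ i - algebraMap K L k by rw [hk]; ring]
    exact sub_mem (IntermediateField.subset_adjoin _ _ ⟨i, hi, rfl⟩)
      (IntermediateField.algebraMap_mem _ k)
  | algebraMap k =>
    obtain ⟨k', hk'⟩ := hK k
    exact hk' ▸ IntermediateField.algebraMap_mem _ k'
  | add x y _ _ hx hy => rw [map_add]; exact add_mem hx hy
  | inv x _ hx => rw [map_inv₀]; exact inv_mem hx
  | mul x y _ _ hx hy => rw [map_mul]; exact mul_mem hx hy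

lemma sub_sum_notMem_range [DecidableEq ι]
    (H : ∀ (T : Finset ι) (s : ι → F), (∃ i ∈ T, s i ≠ 0) →
      ∑ i ∈ T, algebraMap F L (s i) * χ i ∉ Set.range (algebraMap K L))
    {S : Finset ι} {a : ι} (ha : a ∉ S) (s : ι → F) :
    χ a - ∑ i ∈ S, algebraMap F L (s i) * χ i ∉ Set.range (algebraMap K L) := fun hs => by
  refine H (insert a S) (Function.update (-s) a 1) ⟨a, by simp⟩ ?_
  rw [Finset.sum_insert ha, Function.update_self, map_one, one_mul]
  convert! hs using 1
  rw [sub_eq_add_neg, ← Finset.sum_neg_distrib]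
  congr 1
  refine Finset.sum_congr rfl fun i hi => ?_
  rw [Function.update_of_ne (ne_of_mem_of_not_mem hi ha)]
  simp

lemma exists_sub_sum_mem_range [CharZero K] [DecidableEq ι]
    (hFK : ∀ c, algebraMap F L c ∈ Set.range (algebraMap K L))
    (hF : ∀ c, σ (algebraMap F L c) = algebraMap F L c)
    (hK : ∀ k, σ (algebraMap K L k) ∈ Set.range (algebraMap K L))
    (hconst : ∀ y, σ y = y → y ∈ Set.range (algebraMap F L))
    (hχ : ∀ i, χ i - σ (χ i) ∈ Set.range (algebraMap K L))
    (H : ∀ (T : Finset ι) (s : ι → F), (∃ i ∈ T, s i ≠ 0) →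
      ∑ i ∈ T, algebraMap F L (s i) * χ i ∉ Set.range (algebraMap K L))
    (S : Finset ι) {y : L} (hy : y ∈ IntermediateField.adjoin K (χ '' S))
    (hyK : y - σ y ∈ Set.range (algebraMap K L)) :
    ∃ s : ι → F, y - ∑ i ∈ S, algebraMap F L (s i) * χ i ∈ Set.range (algebraMap K L) := by
  induction S using Finset.induction_on generalizing y with
  | empty =>
    rw [Finset.coe_empty, Set.image_empty, IntermediateField.adjoin_empty,
      IntermediateField.mem_bot] at hy
    exact ⟨0, by simpa using hy⟩
  | insert a S ha ih =>
    set E := IntermediateField.adjoin K (χ '' S) with hE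
    have hKE : ∀ {z : L}, z ∈ Set.range (algebraMap K L) → z ∈ Set.range (algebraMap E L) := by
      rintro z ⟨k, rfl⟩
      exact ⟨⟨_, E.algebraMap_mem k⟩, rfl⟩
    have hrange : ∀ {z : L}, z ∈ Set.range (algebraMap E L) ↔ z ∈ E := fun {z} =>
      ⟨by rintro ⟨w, rfl⟩; exact w.2, fun h => ⟨⟨z, h⟩, rfl⟩⟩
    let τ : E →+* E := σ.restrict E E
      fun x hx => map_mem_adjoin_of_sub_map_mem_range hK hχ (S : Set ι) hx
    have hτ : ∀ e, σ (algebraMap E L e) = algebraMap E L (τ e) := fun e => rfl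
    have hcE : ∀ y, σ y = y → y ∈ Set.range (algebraMap E L) := fun y h => by
      obtain ⟨c, rfl⟩ := hconst y h
      exact hKE (hFK c)
    obtain ⟨q, hq⟩ := hKE (hχ a)
    obtain ⟨e, he⟩ := hKE hyK
    have hχE : χ a ∉ Set.range (algebraMap E L) := fun hmem => by
      obtain ⟨s, hs⟩ := ih (hrange.1 hmem) (hχ a)
      exact sub_sum_notMem_range H ha s hs
    obtain ⟨r, s, hrs⟩ : ∃ r s : E[X], y = aeval (χ a) r / aeval (χ a) s := by
      rw [← IntermediateField.mem_adjoin_simple_iff,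
        ← IntermediateField.mem_restrictScalars K, IntermediateField.adjoin_adjoin_left]
      rwa [Finset.coe_insert, Set.image_insert_eq, ← Set.union_singleton] at hy
    obtain ⟨c, hc, hyc⟩ := exists_const_mul_sub_mem_range hτ hcE hq.symm hχE he.symm hrs
    obtain ⟨c', hc'⟩ := hconst (algebraMap E L c) (by rw [hτ, hc])
    rw [← hc'] at hyc
    -- The constant `c'` comes from `F`, hence lies in `K`, so subtracting `c' χ_a` keeps the
    -- difference in `K`, as the induction requires.
    obtain ⟨s', hs'⟩ := ih (hrange.1 hyc) (by
      obtain ⟨k, hk⟩ := hyK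
      obtain ⟨l, hl⟩ := hχ a
      obtain ⟨m, hm⟩ := hFK c'
      refine ⟨k - m * l, ?_⟩
      rw [map_sub, map_sub, map_mul, map_mul, hk, hl, hm, hF]
      ring)
    refine ⟨Function.update s' a c', ?_⟩
    rw [Finset.sum_insert ha, Function.update_self, ← sub_sub]
    convert! hs' using 2
    refine Finset.sum_congr rfl fun i hi => ?_
    rw [Function.update_of_ne (ne_of_mem_of_not_mem hi ha)]

/-- Ostrowski's theorem for difference fields: solutions of `χ i - σ (χ i) ∈ K` are algebraically
independent over `K`, unless a nontrivial combination with constant coefficients lies in `K`. -/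
theorem algebraicIndependent_of_sub_map_mem_range [CharZero K] [Finite ι]
    (hFK : ∀ c, algebraMap F L c ∈ Set.range (algebraMap K L))
    (hF : ∀ c, σ (algebraMap F L c) = algebraMap F L c)
    (hK : ∀ k, σ (algebraMap K L k) ∈ Set.range (algebraMap K L))
    (hconst : ∀ y, σ y = y → y ∈ Set.range (algebraMap F L))
    (hχ : ∀ i, χ i - σ (χ i) ∈ Set.range (algebraMap K L))
    (H : ∀ (T : Finset ι) (s : ι → F), (∃ i ∈ T, s i ≠ 0) →
      ∑ i ∈ T, algebraMap F L (s i) * χ i ∉ Set.range (algebraMap K L)) :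
    AlgebraicIndependent K χ := by
  classical
  have := Fintype.ofFinite ι
  suffices h : ∀ S : Finset ι, AlgebraicIndepOn K χ (S : Set ι) by
    have h' := h Finset.univ
    rw [Finset.coe_univ] at h'
    exact (algebraicIndependent_equiv (Equiv.Set.univ ι)).1 h'
  intro S
  induction S using Finset.induction_on with
  | empty =>
    rw [Finset.coe_empty]
    exact algebraicIndependent_empty_type_iff.2 (algebraMap K L).injective
  | insert a S ha ih =>
    rw [Finset.coe_insert]
    refine ih.insert fun halg => ?_
    set E := IntermediateField.adjoin K (χ '' S) with hE
    have hχE : χ a ∈ E := by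
      let τ : E →+* E := σ.restrict E E
        fun x hx => map_mem_adjoin_of_sub_map_mem_range hK hχ (S : Set ι) hx
      obtain ⟨l, hl⟩ := hχ a
      have halgE : IsAlgebraic E (χ a) :=
        IsAlgebraic.tower_top_of_subalgebra_le (B := E.toSubalgebra)
          (IntermediateField.algebra_adjoin_le_adjoin K _) halg
      obtain ⟨w, hw⟩ := mem_range_of_isAlgebraic (τ := τ) (σ := σ)
        (q := (⟨_, E.algebraMap_mem l⟩ : E)) (fun e => rfl) (fun y h => by
          obtain ⟨c, rfl⟩ := hconst y h
          obtain ⟨k, hk⟩ := hFK c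
          exact ⟨⟨_, E.algebraMap_mem k⟩, hk⟩) hl.symm halgE
      exact hw ▸ w.2
    obtain ⟨s, hs⟩ := exists_sub_sum_mem_range hFK hF hK hconst hχ H S hχE (hχ a)
    exact sub_sum_notMem_range H ha s hs

end Ostrowski

/-! ### Power series fixed by an endomorphism -/

namespace PowerSeries

variable {k : Type*} [Field k]

lemma exists_eq_X_pow_mul {f : k⟦X⟧} (hf : f ≠ 0) :
    ∃ (n : ℕ) (u : k⟦X⟧), constantCoeff u ≠ 0 ∧ f = X ^ n * u :=
  ⟨_, f.divXPowOrder, constantCoeff_divXPowOrder_eq_zero_iff.not.2 hf,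
    X_pow_order_mul_divXPowOrder.symm⟩

variable {τ : k⟦X⟧ →ₐ[k] k⟦X⟧}

lemma algHom_coe_polynomial {p : k[X]} (hτ : τ X = (p : k⟦X⟧)) (A : k[X]) :
    τ (A : k⟦X⟧) = (A.comp p : k[X]) := by
  have hcoe : ∀ B : k[X], coeToPowerSeries.algHom k B = (B : k⟦X⟧) := fun B => by
    rw [coeToPowerSeries.algHom_apply, Algebra.algebraMap_self, PowerSeries.map_id, id]
  have h : τ.comp (coeToPowerSeries.algHom k) =
      (coeToPowerSeries.algHom k).comp (Polynomial.aeval p) := by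
    apply Polynomial.algHom_ext
    rw [AlgHom.comp_apply, AlgHom.comp_apply, hcoe, Polynomial.aeval_X, hcoe, Polynomial.coe_X, hτ]
  have h1 := AlgHom.congr_fun h A
  rwa [AlgHom.comp_apply, AlgHom.comp_apply, hcoe, hcoe] at h1

/-- An endomorphism of the power series algebra that fixes the variable up to `X ^ r` fixes every
series up to `X ^ r`. -/
lemma X_pow_dvd_algHom_sub {r : ℕ} (hr : r ≠ 0) (hτ : (X : k⟦X⟧) ^ r ∣ τ X - X) (u : k⟦X⟧) :
    (X : k⟦X⟧) ^ r ∣ τ u - u := by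
  have hX : (X : k⟦X⟧) ∣ τ X := by
    have := dvd_add ((dvd_pow_self X hr).trans hτ) (dvd_refl X)
    rwa [sub_add_cancel] at this
  have hpoly : ∀ A : k[X], (X : k⟦X⟧) ^ r ∣ τ (A : k⟦X⟧) - A := fun A => by
    induction A using Polynomial.induction_on' with
    | add A B hA hB =>
      rw [Polynomial.coe_add, map_add, add_sub_add_comm]
      exact dvd_add hA hB
    | monomial n a =>
      have h : ((Polynomial.monomial n a : k[X]) : k⟦X⟧) = a • X ^ n := by
        rw [Polynomial.coe_monomial, ← mul_one a, ← smul_eq_mul, map_smul, X_pow_eq,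
          smul_eq_mul, mul_one]
      rw [h, map_smul, map_pow, ← smul_sub]
      exact (hτ.trans (sub_dvd_pow_sub_pow _ _ n)).trans (Dvd.intro (C a) (by
        rw [smul_eq_C_mul, mul_comm]))
  -- No continuity of `τ` is needed: the tail is divisible by `X ^ r` before and after `τ`, leaving
  -- a polynomial.
  rw [eq_X_pow_mul_shift_add_trunc r u, map_add, add_sub_add_comm, map_mul, map_pow]
  exact dvd_add (dvd_sub ((pow_dvd_pow_of_dvd hX r).mul_right _) (dvd_mul_right _ _)) (hpoly _)

lemma constantCoeff_algHom (hτ : (X : k⟦X⟧) ∣ τ X) (u : k⟦X⟧) :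
    constantCoeff (τ u) = constantCoeff u := by
  have h := X_pow_dvd_algHom_sub one_ne_zero (τ := τ)
    (by rw [pow_one]; exact dvd_sub hτ dvd_rfl) u
  rwa [pow_one, X_dvd_iff, map_sub, sub_eq_zero] at h

lemma exists_of_algHom_fixed {f : k⟦X⟧} (hf : τ f = f) (hf0 : f ≠ C (constantCoeff f)) :
    ∃ (n : ℕ) (u : k⟦X⟧), n ≠ 0 ∧ constantCoeff u ≠ 0 ∧ τ (X ^ n * u) = X ^ n * u ∧
      f = C (constantCoeff f) + X ^ n * u := by
  obtain ⟨n, u, hu, hn⟩ := exists_eq_X_pow_mul (sub_ne_zero.2 hf0)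
  refine ⟨n, u, ?_, hu, ?_, by rw [← hn]; ring⟩
  · rintro rfl
    apply hu
    rw [pow_zero, one_mul] at hn
    rw [← hn]
    simp
  · rw [← hn, map_sub, hf]
    congr 1
    exact τ.commutes _

/-- Compare the lowest nonconstant coefficients of `f` and `τ f`. -/
lemma exists_pow_eq_one_of_algHom_fixed {w : k⟦X⟧} (hw : τ X = X * w) {f : k⟦X⟧}
    (hf : τ f = f) (hf0 : f ≠ C (constantCoeff f)) :
    ∃ n ≠ 0, constantCoeff w ^ n = 1 := by
  obtain ⟨n, u, hn, hu, hfix, -⟩ := exists_of_algHom_fixed hf hf0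
  refine ⟨n, hn, ?_⟩
  rw [map_mul, map_pow, hw, mul_pow, mul_assoc] at hfix
  have h := congrArg constantCoeff (mul_left_cancel₀ (pow_ne_zero n X_ne_zero) hfix)
  rw [map_mul, map_pow, constantCoeff_algHom ⟨w, hw⟩] at h
  exact mul_right_cancel₀ hu (by rw [h, one_mul])

/-- An endomorphism tangent to the identity, but distinct from it, fixes only the constants. -/
lemma eq_C_of_algHom_fixed [CharZero k] (hτ : X ^ 2 ∣ τ X - X) (hne : τ X ≠ X) {f : k⟦X⟧}
    (hf : τ f = f) : f = C (constantCoeff f) := by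
  by_contra hf0
  obtain ⟨n, u, hn, hu, hfix, -⟩ := exists_of_algHom_fixed hf hf0
  obtain ⟨r, v, hv, hr⟩ := exists_eq_X_pow_mul (sub_ne_zero.2 hne)
  have hr2 : 2 ≤ r := by
    by_contra! hlt
    apply hv
    rw [hr, show 2 = r + (1 + (1 - r)) by omega, pow_add,
      mul_dvd_mul_iff_left (pow_ne_zero r X_ne_zero), pow_add, pow_one] at hτ
    exact X_dvd_iff.1 ((dvd_mul_right _ _).trans hτ)
  obtain ⟨s, rfl⟩ : ∃ s, r = s + 1 + 1 := ⟨r - 2, by omega⟩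
  obtain ⟨h, hh⟩ := X_pow_dvd_algHom_sub (by omega) ⟨v, hr⟩ u
  have hX : τ X = X * (1 + X ^ (s + 1) * v) := by linear_combination hr
  obtain ⟨y, hy⟩ := powAddExpansion 1 (X ^ (s + 1) * v) n
  rw [map_mul, map_pow, hX, mul_pow, mul_assoc] at hfix
  have h1 := mul_left_cancel₀ (pow_ne_zero n X_ne_zero) hfix
  rw [hy, show τ u = u + X ^ (s + 1 + 1) * h by rw [← hh]; ring, one_pow, one_pow] at h1
  -- The lowest term of `τ f - f` has coefficient `n v(0) u(0)`, nonzero in characteristic zero.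
  have h2 : X ^ (s + 1) * ((n : k⟦X⟧) * v * u + X * (h + (n : k⟦X⟧) * X ^ (s + 1) * v * h +
      y * X ^ s * v ^ 2 * (u + X ^ (s + 1 + 1) * h))) = X ^ (s + 1) * 0 := by
    linear_combination h1
  have h3 := congrArg constantCoeff (mul_left_cancel₀ (pow_ne_zero (s + 1) X_ne_zero) h2)
  simp only [map_add, map_mul, map_natCast, constantCoeff_X, zero_mul, add_zero, map_zero,
    mul_eq_zero, Nat.cast_eq_zero, hn, hv, hu, or_self] at h3

/-- The composition with a polynomial `p` with zero constant term, other than `ζ * X` with `ζ` a root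
of unity, fixes only the constants. -/
lemma eq_C_of_algHom_polynomial_fixed [CharZero k] {p : k[X]} (hτ : τ X = (p : k⟦X⟧))
    (hp0 : p.eval 0 = 0) (hp : p ≠ 0)
    (hpz : ∀ (ζ : k) (m : ℕ), 1 ≤ m → ζ ^ m = 1 → p ≠ Polynomial.C ζ * Polynomial.X)
    {f : k⟦X⟧} (hf : τ f = f) : f = C (constantCoeff f) := by
  by_contra hf0
  obtain ⟨w, rfl⟩ : (Polynomial.X : k[X]) ∣ p := by
    rwa [Polynomial.X_dvd_iff, coeff_zero_eq_eval_zero]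
  obtain ⟨n, hn, hwn⟩ := exists_pow_eq_one_of_algHom_fixed (w := (w : k⟦X⟧))
    (by rw [hτ, Polynomial.coe_mul, Polynomial.coe_X]) hf hf0
  rw [← coeff_zero_eq_constantCoeff_apply, Polynomial.coeff_coe] at hwn
  have hw0 : w ≠ 0 := right_ne_zero_of_mul hp
  have hdw : w.natDegree ≠ 0 := fun h => hpz (w.coeff 0) n (Nat.one_le_iff_ne_zero.2 hn) hwn (by
    conv_lhs => rw [eq_C_of_natDegree_eq_zero h, mul_comm])
  have hd : 1 < (Polynomial.X * w).natDegree := by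
    rw [natDegree_X_mul hw0]; omega
  -- The multiplier `w(0)` is a root of unity but `p` is not linear, so the `n`-th iterate is
  -- tangent to the identity, and differs from it by degree.
  have hiter : ∀ j : ℕ, ∃ P : k[X], (τ ^ j) X = (P : k⟦X⟧) ∧
      P.natDegree = (Polynomial.X * w).natDegree ^ j ∧ P.coeff 0 = 0 ∧
      P.coeff 1 = w.coeff 0 ^ j := by
    intro j
    induction j with
    | zero => exact ⟨Polynomial.X, by simp⟩
    | succ j ih =>
      obtain ⟨P, h1, h2, h3, h4⟩ := ih
      obtain ⟨Q, rfl⟩ := Polynomial.X_dvd_iff.2 h3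
      refine ⟨(Polynomial.X * Q).comp (Polynomial.X * w), ?_, ?_, ?_, ?_⟩
      · rw [pow_succ', AlgHom.mul_apply, h1, algHom_coe_polynomial hτ]
      · rw [natDegree_comp, h2, pow_succ]
      · simp
      · rw [Polynomial.coeff_X_mul] at h4
        rw [mul_comp, X_comp, mul_assoc, Polynomial.coeff_X_mul, mul_coeff_zero, pow_succ', ← h4]
        congr 1
        simp [coeff_zero_eq_eval_zero]
  obtain ⟨P, h1, h2, h3, h4⟩ := hiter n
  refine hf0 (eq_C_of_algHom_fixed (τ := τ ^ n) ?_ (fun h => ?_) ?_)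
  · rw [h1, hwn] at *
    rw [X_pow_dvd_iff]
    intro m hm
    interval_cases m <;> simp [h3, h4]
  · rw [h1, ← Polynomial.coe_X, Polynomial.coe_inj] at h
    rw [h, natDegree_X] at h2
    exact (Nat.one_lt_pow hn hd).ne h2
  · rw [AlgHom.coe_pow]
    exact Function.iterate_fixed hf n

end PowerSeries

/-! ### Composition with `p` on Laurent series -/

lemma PowerSeries.subst_injective_of_constantCoeff_zero {k : Type*} [Field k] {p : PowerSeries k}
    (hp0 : p.constantCoeff = 0) (hp : p ≠ 0) :
    Function.Injective (substAlgHom (R := k) (HasSubst.of_constantCoeff_zero' hp0)) := by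
  set τ : PowerSeries k →ₐ[k] PowerSeries k := substAlgHom (HasSubst.of_constantCoeff_zero' hp0)
  have hτ : τ X = p := substAlgHom_X _
  refine (injective_iff_map_eq_zero τ).2 fun f hf => ?_
  by_contra hf0
  obtain ⟨n, u, hu, rfl⟩ := exists_eq_X_pow_mul hf0
  rw [map_mul, map_pow, hτ] at hf
  rcases mul_eq_zero.1 hf with h | h
  · exact pow_ne_zero n hp h
  · apply hu
    rw [← constantCoeff_algHom (τ := τ) (by rw [hτ]; exact X_dvd_iff.2 hp0), h, map_zero]

lemma exists_ringHom_eq_laurentComp {p : ℂ[X]} (hp0 : p.eval 0 = 0) (hp : p ≠ 0) :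
    ∃ (τ : PowerSeries ℂ →ₐ[ℂ] PowerSeries ℂ) (σ : LaurentSeries ℂ →+* LaurentSeries ℂ),
      τ PowerSeries.X = p ∧ (∀ g : PowerSeries ℂ, σ g = (τ g : PowerSeries ℂ)) ∧
      ∀ f, σ f = laurentComp f p := by
  have hp0' : PowerSeries.constantCoeff (p : PowerSeries ℂ) = 0 := by
    rw [← PowerSeries.coeff_zero_eq_constantCoeff_apply, Polynomial.coeff_coe,
      coeff_zero_eq_eval_zero, hp0]
  have hp' : (p : PowerSeries ℂ) ≠ 0 := by
    rwa [Ne, ← Polynomial.coe_zero, Polynomial.coe_inj]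
  have hs := PowerSeries.HasSubst.of_constantCoeff_zero' hp0'
  let τ : PowerSeries ℂ →ₐ[ℂ] PowerSeries ℂ := PowerSeries.substAlgHom hs
  have hτ : Function.Injective τ := PowerSeries.subst_injective_of_constantCoeff_zero hp0' hp'
  have hg : Function.Injective
      ((algebraMap (PowerSeries ℂ) (LaurentSeries ℂ)).comp (τ : PowerSeries ℂ →+* PowerSeries ℂ)) :=
    (FaithfulSMul.algebraMap_injective (PowerSeries ℂ) (LaurentSeries ℂ)).comp hτ
  let σ : LaurentSeries ℂ →+* LaurentSeries ℂ := IsFractionRing.lift hg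
  have hσ : ∀ g : PowerSeries ℂ, σ g = (τ g : PowerSeries ℂ) := fun g =>
    IsFractionRing.lift_algebraMap hg g
  have hτX : τ PowerSeries.X = p := PowerSeries.substAlgHom_X hs
  refine ⟨τ, σ, hτX, hσ, fun f => ?_⟩
  conv_lhs => rw [← LaurentSeries.single_order_mul_powerSeriesPart f, map_mul, hσ,
    RatFunc.single_zpow, ← PowerSeries.coe_X, map_zpow₀, hσ, hτX]
  rw [laurentComp]
  congr 2
  exact congrFun (PowerSeries.coe_substAlgHom hs) f.powerSeriesPart

lemma LaurentSeries.algebraMap_eq_coe_C (c : ℂ) :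
    algebraMap ℂ (LaurentSeries ℂ) c = (PowerSeries.C c : PowerSeries ℂ) := rfl

lemma LaurentSeries.smul_eq_algebraMap_mul (c : ℂ) (f : LaurentSeries ℂ) :
    c • f = algebraMap ℂ (LaurentSeries ℂ) c * f := by
  rw [algebraMap_eq_coe_C, PowerSeries.coe_C, HahnSeries.C_mul_eq_smul]

lemma LaurentSeries.algebraMap_ratFunc_algebraMap (A : ℂ[X]) :
    algebraMap (RatFunc ℂ) (LaurentSeries ℂ) (algebraMap ℂ[X] (RatFunc ℂ) A) =
      (A : PowerSeries ℂ) := (RatFunc.coe_coe A).symm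

/-! ### Constants and rational solutions -/

section

variable {p : ℂ[X]} {τ : PowerSeries ℂ →ₐ[ℂ] PowerSeries ℂ}
  {σ : LaurentSeries ℂ →+* LaurentSeries ℂ}

lemma mem_range_algebraMap_of_fixed (hτ : τ PowerSeries.X = p)
    (hσ : ∀ g : PowerSeries ℂ, σ g = (τ g : PowerSeries ℂ)) (hp0 : p.eval 0 = 0) (hp : p ≠ 0)
    (hpz : ∀ (ζ : ℂ) (m : ℕ), 1 ≤ m → ζ ^ m = 1 → p ≠ C ζ * X)
    {y : LaurentSeries ℂ} (hy : σ y = y) : y ∈ Set.range (algebraMap ℂ (LaurentSeries ℂ)) := by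
  have key : ∀ y : LaurentSeries ℂ, σ y = y → IsLocalization.IsInteger (PowerSeries ℂ) y →
      y ∈ Set.range (algebraMap ℂ (LaurentSeries ℂ)) := by
    rintro y hy ⟨g, rfl⟩
    have hg : τ g = g := by
      apply FaithfulSMul.algebraMap_injective (PowerSeries ℂ) (LaurentSeries ℂ)
      rw [← hy]
      exact (hσ g).symm
    refine ⟨PowerSeries.constantCoeff g, ?_⟩
    rw [PowerSeries.eq_C_of_algHom_polynomial_fixed hτ hp0 hp hpz hg,
      LaurentSeries.algebraMap_eq_coe_C]
    simp [LaurentSeries.coe_algebraMap]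
  -- Either `y` or its inverse is a power series.
  rcases ValuationRing.isInteger_or_isInteger (PowerSeries ℂ) y with h | h
  · exact key y hy h
  · obtain ⟨c, hc⟩ := key y⁻¹ (by rw [map_inv₀, hy]) h
    exact ⟨c⁻¹, by rw [map_inv₀, hc, inv_inv]⟩

/-- By degree, `B(az) = c B(z)`, so `a ^ n = c` for every exponent `n` of `B`; the powers of `a`
being distinct, there is only one. -/
lemma eq_monomial_of_dvd_comp_C_mul_X {a : ℂ} (ha : ∀ m : ℕ, 1 ≤ m → a ^ m ≠ 1) (ha0 : a ≠ 0)
    {B : ℂ[X]} (hB : B.Monic) (hdvd : B ∣ B.comp (C a * X)) : B = X ^ B.natDegree := by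
  obtain ⟨D, hD⟩ := hdvd
  have hdeg : (B.comp (C a * X)).natDegree = B.natDegree := by
    rw [natDegree_comp, natDegree_C_mul_X a ha0, mul_one]
  have hne : B.comp (C a * X) ≠ 0 := fun h => by
    rw [comp_C_mul_X_eq_zero_iff (mem_nonZeroDivisors_of_ne_zero ha0)] at h
    exact hB.ne_zero h
  have hD0 : D ≠ 0 := right_ne_zero_of_mul (hD ▸ hne)
  have hDdeg : D.natDegree = 0 := by
    rw [hD, natDegree_mul hB.ne_zero hD0] at hdeg
    omega
  obtain ⟨c, rfl⟩ : ∃ c, D = C c := ⟨_, eq_C_of_natDegree_eq_zero hDdeg⟩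
  have hco : ∀ n, B.coeff n * a ^ n = B.coeff n * c := fun n => by
    have := congrArg (fun F => coeff F n) hD
    simpa [comp_C_mul_X_coeff] using this
  have hc : a ^ B.natDegree = c := by simpa [hB.coeff_natDegree] using hco B.natDegree
  ext n
  rw [coeff_X_pow]
  split_ifs with h
  · rw [h, hB.coeff_natDegree]
  · by_contra hn
    have hlt : n < B.natDegree := lt_of_le_of_ne (le_natDegree_of_ne_zero hn) h
    have h1 := mul_left_cancel₀ hn (hco n)
    refine ha (B.natDegree - n) (by omega) (mul_left_cancel₀ (pow_ne_zero n ha0) ?_)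
    rw [← pow_add, Nat.add_sub_cancel' hlt.le, hc, h1, mul_one]

lemma exists_polynomial_of_sub_map_eq (hτ : τ PowerSeries.X = p)
    (hσ : ∀ g : PowerSeries ℂ, σ g = (τ g : PowerSeries ℂ)) (hp0 : p.eval 0 = 0) (hp : p ≠ 0)
    (hpz : ∀ (ζ : ℂ) (m : ℕ), 1 ≤ m → ζ ^ m = 1 → p ≠ C ζ * X) {f : RatFunc ℂ} {Q : ℂ[X]}
    (hf : algebraMap (RatFunc ℂ) (LaurentSeries ℂ) f -
      σ (algebraMap (RatFunc ℂ) (LaurentSeries ℂ) f) = (Q : PowerSeries ℂ)) :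
    ∃ g : ℂ[X], f = algebraMap ℂ[X] (RatFunc ℂ) g := by
  obtain ⟨w, hw⟩ : X ∣ p := by rwa [Polynomial.X_dvd_iff, coeff_zero_eq_eval_zero]
  have hd : p.natDegree ≠ 0 := by
    rw [hw, natDegree_X_mul (right_ne_zero_of_mul (hw ▸ hp))]
    omega
  set A := f.num with hA
  set B := f.denom with hB
  have hBmon : B.Monic := f.monic_denom
  have hcop : IsCoprime A B := f.isCoprime_num_denom
  have hcop' : IsCoprime (A.comp p) (B.comp p) := hcop.map (compRingHom p)
  have hBp : B.comp p ≠ 0 := fun h => by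
    have h0 := congrArg natDegree h
    rw [natDegree_comp, natDegree_zero, mul_eq_zero, or_iff_left hd] at h0
    rw [hBmon.natDegree_eq_zero.1 h0, one_comp] at h
    exact one_ne_zero h
  have hrel : A * B.comp p = A.comp p * B + Q * B * B.comp p := by
    have hinj : ∀ {P R : ℂ[X]}, ((P : PowerSeries ℂ) : LaurentSeries ℂ) = (R : PowerSeries ℂ) →
        P = R := fun h =>
      Polynomial.coe_inj.1 (FaithfulSMul.algebraMap_injective (PowerSeries ℂ) (LaurentSeries ℂ) h)
    have hne : ∀ {P : ℂ[X]}, P ≠ 0 → ((P : PowerSeries ℂ) : LaurentSeries ℂ) ≠ 0 := fun hP h =>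
      hP (hinj (by rw [h, Polynomial.coe_zero, map_zero]))
    have hBL := hne hBmon.ne_zero
    have hBpL := hne hBp
    rw [← f.num_div_denom, ← hA, ← hB, map_div₀, LaurentSeries.algebraMap_ratFunc_algebraMap,
      LaurentSeries.algebraMap_ratFunc_algebraMap, map_div₀, hσ, hσ,
      PowerSeries.algHom_coe_polynomial hτ, PowerSeries.algHom_coe_polynomial hτ] at hf
    apply hinj
    simp only [Polynomial.coe_mul, Polynomial.coe_add, map_mul, map_add]
    field_simp at hf
    linear_combination hf
  -- Mutual divisibility gives `deg B * deg p = deg B`: either `B = 1` or `p = a z`. In the latter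
  -- case `B = z ^ m`, and evaluation at 0 gives `a ^ m = 1`.
  have h1 : B ∣ B.comp p := hcop.symm.dvd_of_dvd_mul_left
    ⟨A.comp p + Q * B.comp p, by rw [hrel]; ring⟩
  have h2 : B.comp p ∣ B := hcop'.symm.dvd_of_dvd_mul_left
    ⟨A - Q * B, by linear_combination -hrel⟩
  have hdeg : B.natDegree * p.natDegree = B.natDegree := by
    rw [← natDegree_comp]
    exact le_antisymm (natDegree_le_of_dvd h2 hBmon.ne_zero) (natDegree_le_of_dvd h1 hBp)
  suffices h : B.natDegree = 0 by
    refine ⟨A, ?_⟩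
    rw [← f.num_div_denom, ← hA, ← hB, hBmon.natDegree_eq_zero.1 h, map_one, div_one]
  by_contra hm
  have hd1 : p.natDegree = 1 := mul_left_cancel₀ hm (by rw [hdeg, mul_one])
  obtain ⟨a, ha0, rfl⟩ : ∃ a ≠ 0, p = C a * X := by
    rw [hw, natDegree_X_mul (right_ne_zero_of_mul (hw ▸ hp))] at hd1
    have hwC := eq_C_of_natDegree_eq_zero (by omega : w.natDegree = 0)
    refine ⟨w.coeff 0, fun h => hp ?_, by rw [hw, mul_comm]; exact congrArg (· * X) hwC⟩
    rw [hw, hwC, h, C_0, mul_zero]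
  have ha : ∀ m : ℕ, 1 ≤ m → a ^ m ≠ 1 := fun m hm h => hpz a m hm h rfl
  have hBX := eq_monomial_of_dvd_comp_C_mul_X ha ha0 hBmon h1
  set m := B.natDegree
  have hA0 : A.eval 0 ≠ 0 := fun h => by
    obtain ⟨u, v, huv⟩ := hcop
    have h0 := congrArg (eval 0) huv
    rw [hBX] at h0
    simp [h, hm] at h0
  rw [hBX, X_pow_comp, mul_pow] at hrel
  have h3 : A * C a ^ m = A.comp (C a * X) + Q * (C a ^ m * X ^ m) :=
    mul_right_cancel₀ (pow_ne_zero m X_ne_zero) (by linear_combination hrel)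
  have h4 := congrArg (eval 0) h3
  simp only [eval_mul, eval_pow, eval_C, eval_add, eval_comp, eval_X, mul_zero, zero_pow hm,
    add_zero] at h4
  exact ha m (Nat.one_le_iff_ne_zero.2 hm) (mul_left_cancel₀ hA0 (by rw [h4, mul_one]))

end

/-! ### Degrees and conclusion -/

lemma natDegree_dvd_natDegree_sub_comp {p : ℂ[X]} (hp : p.natDegree ≠ 0) (g : ℂ[X]) :
    p.natDegree ∣ (g - g.comp p).natDegree := by
  rcases Nat.eq_zero_or_pos g.natDegree with hg | hg
  · rw [eq_C_of_natDegree_eq_zero hg]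
    simp
  · rcases eq_or_ne p.natDegree 1 with h1 | h1
    · rw [h1]
      exact one_dvd _
    · rw [natDegree_sub_eq_right_of_natDegree_lt, natDegree_comp]
      · exact dvd_mul_left _ _
      · rw [natDegree_comp]
        exact lt_mul_of_one_lt_right hg (by omega)

theorem mainTheorem8 (n : ℕ) (hn : 1 ≤ n) (p : ℂ[X]) (q : Fin n → ℂ[X])
    (χ : Fin n → LaurentSeries ℂ)
    (hp0 : p.eval 0 = 0) (hp : p ≠ 0)
    (hpz : ∀ (ζ : ℂ) (m : ℕ), 1 ≤ m → ζ ^ m = 1 → p ≠ C ζ * X)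
    (hq0 : ∀ i, (q i).eval 0 = 0)
    (hχ : ∀ i, χ i = laurentComp (χ i) p + ((q i : PowerSeries ℂ) : LaurentSeries ℂ))
    (hlin : LinearIndependent ℂ (Fin.cons 1 q : Fin (n + 1) → ℂ[X]))
    (hab :
      (∀ s : Fin n → ℂ, s ≠ 0 → ¬ p.natDegree ∣ (∑ i, s i • q i).natDegree) ∨
      (∀ s : Fin n → ℂ, s ≠ 0 →
        ¬ ∃ f : ℂ[X], ∑ i, s i • χ i = ((f : PowerSeries ℂ) : LaurentSeries ℂ))) :
    AlgebraicIndependent (RatFunc ℂ) χ := by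
  obtain ⟨τ, σ, hτ, hσ, hσc⟩ := exists_ringHom_eq_laurentComp hp0 hp
  have hsub : ∀ i, χ i - σ (χ i) = ((q i : PowerSeries ℂ) : LaurentSeries ℂ) := fun i => by
    rw [hσc, sub_eq_iff_eq_add, add_comm]
    exact hχ i
  have hσF : ∀ c, σ (algebraMap ℂ (LaurentSeries ℂ) c) = algebraMap ℂ (LaurentSeries ℂ) c :=
    fun c => by
      rw [LaurentSeries.algebraMap_eq_coe_C, hσ]
      congr 1
      exact τ.commutes c
  have hpoly : ∀ A : ℂ[X], σ (A : PowerSeries ℂ) = ((A.comp p : ℂ[X]) : PowerSeries ℂ) := fun A => by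
    rw [hσ, PowerSeries.algHom_coe_polynomial hτ]
  refine algebraicIndependent_of_sub_map_mem_range (F := ℂ) (σ := σ) (fun c => ?_) hσF (fun f => ?_)
    (fun y hy => mem_range_algebraMap_of_fixed hτ hσ hp0 hp hpz hy) (fun i => ?_) ?_
  · exact ⟨algebraMap ℂ[X] (RatFunc ℂ) (C c), by
      rw [LaurentSeries.algebraMap_ratFunc_algebraMap, Polynomial.coe_C,
        LaurentSeries.algebraMap_eq_coe_C]⟩
  · refine ⟨algebraMap ℂ[X] (RatFunc ℂ) (f.num.comp p) / algebraMap _ _ (f.denom.comp p), ?_⟩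
    conv_rhs => rw [← f.num_div_denom]
    simp only [map_div₀, LaurentSeries.algebraMap_ratFunc_algebraMap, hpoly]
  · exact ⟨algebraMap ℂ[X] (RatFunc ℂ) (q i), by
      rw [LaurentSeries.algebraMap_ratFunc_algebraMap, hsub]⟩
  · rintro T s ⟨j, hj, hsj⟩ ⟨f, hf⟩
    -- Extension by zero turns the sum over `T` into a sum over all indices.
    set s' : Fin n → ℂ := fun i => if i ∈ T then s i else 0 with hs'
    have hs0 : s' ≠ 0 := fun h => hsj (by simpa [hs', hj] using congrFun h j)
    have hsum : ∑ i, s' i • χ i = algebraMap (RatFunc ℂ) (LaurentSeries ℂ) f := by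
      rw [hf, ← Finset.sum_subset (Finset.subset_univ T)]
      · refine Finset.sum_congr rfl fun i hi => ?_
        rw [LaurentSeries.smul_eq_algebraMap_mul, hs']
        simp [hi]
      · intro i _ hi
        rw [LaurentSeries.smul_eq_algebraMap_mul, hs']
        simp [hi]
    have hQ : algebraMap (RatFunc ℂ) (LaurentSeries ℂ) f -
        σ (algebraMap (RatFunc ℂ) (LaurentSeries ℂ) f) =
          ((∑ i, s' i • q i : ℂ[X]) : PowerSeries ℂ) := by
      have hcoe : ((∑ i, s' i • q i : ℂ[X]) : PowerSeries ℂ) =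
          ∑ i, PowerSeries.C (s' i) * (q i : PowerSeries ℂ) := by
        rw [← Polynomial.coeToPowerSeries.ringHom_apply, map_sum]
        simp [Polynomial.smul_eq_C_mul]
      rw [← hsum, hcoe, map_sum, map_sum, ← Finset.sum_sub_distrib]
      refine Finset.sum_congr rfl fun i _ => ?_
      rw [LaurentSeries.smul_eq_algebraMap_mul, map_mul, hσF, ← mul_sub, hsub, map_mul,
        LaurentSeries.algebraMap_eq_coe_C]
    obtain ⟨g, rfl⟩ := exists_polynomial_of_sub_map_eq hτ hσ hp0 hp hpz hQ
    rw [LaurentSeries.algebraMap_ratFunc_algebraMap] at hsum hQ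
    rcases hab with ha | hb
    · refine ha s' hs0 ?_
      rw [hpoly, ← map_sub, ← Polynomial.coe_sub] at hQ
      rw [← Polynomial.coe_inj.1
        (FaithfulSMul.algebraMap_injective (PowerSeries ℂ) (LaurentSeries ℂ) hQ)]
      refine natDegree_dvd_natDegree_sub_comp (fun h => hp ?_) g
      rw [eq_C_of_natDegree_eq_zero h, coeff_zero_eq_eval_zero, hp0, C_0]
    · exact hb s' hs0 ⟨g, hsum⟩
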